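/- Let $V$ be Thompson's group, i.e. the group of all permutations $g$ of the set $\{a,b\}^{\omega}$ of infinite words for which there are finite maximal prefix codes $P,Q\subset\{a,b\}^*$ and a bijection $\tau:P\to Q$ with $g(py)=\tau(p)y$ for all $p\in P$ and $y\in\{a,b\}^{\omega}$. For a subset $S$ of a group and an element $g$ of the subgroup $\langle S\rangle$, let $|g|_S$ be the minimal length of a word over $S\cup S^{-1}$ representing $g$. If $A$ is a finite generating set of a group and $X$ is a finite subset of that group, a *distortion function* of $\langle X\rangle$ (with respect to $A$ and $X$) is any non-decreasing function $f:\mathbb{N}\to\mathbb{N}$ such that $|g|_X\le f(|g|_A)$ for all $g\in\langle X\rangle$ (the function $f$ is not required to be the smallest one). Two functions $f_1,f_2:\mathbb{N}\to\mathbb{N}$ are *linearly equivalent* if there are positive integers $c_0,C_{12},c_{12},C_{21},c_{21}$ such that $f_1(n)\le C_{12}f_2(c_{12}n)$ and $f_2(n)\le C_{21}f_1(c_{21}n)$ for all $n\ge c_0$. **Proposition.** Let $G$ be a finitely generated subgroup of $V$, and let $\delta$ be a distortion function of $G$ in $V$ (with respect to some finite generating set $A$ of $V$ and some finite generating set $X$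 of $G$). Then $V$ contains a finitely generated subgroup $K\cong G\times G$ such that, for every finite generating set $B$ of $V$ and every finite generating set $Y$ of $K$, the subgroup $K$ has a distortion function (with respect to $B$ and $Y$) that is linearly equivalent to $n\mapsto\delta(\lceil n\log_2 n\rceil)$ (where $n\log_2 n$ is read as $0$ for $n=0$). -/

import Mathlib

/-- A prefix code over the alphabet `{a, b}` (modelled by `Bool`): a set of finite words none of
which is a strict prefix of another one. -/
def IsPrefixCode (C : Set (List Bool)) : Prop :=
  ∀ u ∈ C, ∀ v ∈ C, u <+: v → u = v

/-- A maximal prefix code: a prefix code that is not a strict subset of another prefix code. -/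
def IsMaximalPrefixCode (C : Set (List Bool)) : Prop :=
  IsPrefixCode C ∧ ∀ D : Set (List Bool), IsPrefixCode D → C ⊆ D → D = C

/-- A permutation `g` of the set of infinite words over `{a, b}` is given by a finite table: there
are finite maximal prefix codes `P`, `Q` and a bijection `τ : P → Q` such that `g (p y) = τ(p) y`
for every `p ∈ P` and every infinite word `y`. -/
def HasFiniteTable (g : Equiv.Perm (Stream' Bool)) : Prop :=
  ∃ P Q : Set (List Bool), P.Finite ∧ Q.Finite ∧ IsMaximalPrefixCode P ∧ IsMaximalPrefixCode Q ∧
    ∃ τ : List Bool → List Bool, Set.BijOn τ P Q ∧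
      ∀ p ∈ P, ∀ y : Stream' Bool, g (Stream'.appendStream' p y) = Stream'.appendStream' (τ p) y

theorem prefix_or_prefix_of_append_eq {u v : List Bool} {x y : Stream' Bool}
    (h : Stream'.appendStream' u x = Stream'.appendStream' v y) : u <+: v ∨ v <+: u := by
  rcases le_total u.length v.length with hl | hl
  · left
    have h1 := congrArg (Stream'.take u.length) h
    rw [Stream'.take_append_of_le_length (h := le_rfl),
      Stream'.take_append_of_le_length (h := hl), List.take_length] at h1
    rw [h1]
    exact List.take_prefix _ _
  · right
    have h1 := congrArg (Stream'.take v.length) h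
    rw [Stream'.take_append_of_le_length (h := le_rfl),
      Stream'.take_append_of_le_length (h := hl), List.take_length] at h1
    rw [← h1]
    exact List.take_prefix _ _

theorem isMaximalPrefixCode_of_covers {C : Set (List Bool)} (hC : IsPrefixCode C)
    (hcov : ∀ x : Stream' Bool, ∃ c ∈ C, ∃ y, x = Stream'.appendStream' c y) :
    IsMaximalPrefixCode C := by
  refine ⟨hC, fun D hD hCD => Set.Subset.antisymm (fun d hd => ?_) hCD⟩
  obtain ⟨c, hc, y, hy⟩ := hcov (Stream'.appendStream' d (Stream'.const true))
  rcases prefix_or_prefix_of_append_eq hy with h | h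
  · rw [hD d hd c (hCD hc) h]
    exact hc
  · rw [← hD c (hCD hc) d hd h]
    exact hc

theorem IsMaximalPrefixCode.exists_prefix {C : Set (List Bool)} (hC : IsMaximalPrefixCode C)
    {w : List Bool} (hw : ∀ c ∈ C, c.length ≤ w.length) : ∃ c ∈ C, c <+: w := by
  by_contra! hno
  have hD : IsPrefixCode (insert w C) := by
    intro u hu v hv huv
    rcases hu with rfl | hu <;> rcases hv with rfl | hv
    · rfl
    · exact huv.eq_of_length (le_antisymm huv.length_le (hw v hv))
    · exact absurd huv (hno u hu)
    · exact hC.1 u hu v hv huv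
  have hwC : w ∈ C := by
    rw [← hC.2 _ hD (Set.subset_insert w C)]
    exact Set.mem_insert w C
  exact hno w hwC (List.prefix_refl w)

theorem hasFiniteTable_iff (g : Equiv.Perm (Stream' Bool)) :
    HasFiniteTable g ↔ ∃ N : ℕ, ∀ w : List Bool, N ≤ w.length →
      ∃ v : List Bool, ∀ y : Stream' Bool, g (Stream'.appendStream' w y) = Stream'.appendStream' v y := by
  constructor
  · rintro ⟨P, Q, hP, -, hPm, -, τ, -, hg⟩
    obtain ⟨N, hN⟩ := (hP.image List.length).bddAbove
    refine ⟨N, fun w hw => ?_⟩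
    obtain ⟨p, hp, z, rfl⟩ := hPm.exists_prefix (w := w)
      (fun c hc => (hN (Set.mem_image_of_mem _ hc)).trans hw)
    refine ⟨τ p ++ z, fun y => ?_⟩
    rw [Stream'.append_append_stream, Stream'.append_append_stream, hg p hp]
  · rintro ⟨N, hN⟩
    choose! τ hτ using hN
    have hPfin : {w : List Bool | w.length = N}.Finite := List.finite_length_eq Bool N
    have key : ∀ w : List Bool, w.length = N → ∀ w' : List Bool, w'.length = N →
        τ w <+: τ w' → w = w' := by
      rintro w hw w' hw' ⟨z, hz⟩
      have h1 : g (Stream'.appendStream' w (Stream'.appendStream' z (Stream'.const true))) =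
          g (Stream'.appendStream' w' (Stream'.const true)) := by
        rw [hτ w hw.ge, hτ w' hw'.ge, ← hz, Stream'.append_append_stream]
      exact Stream'.append_left_injective _ _ _ _ (g.injective h1) (hw.trans hw'.symm)
    refine ⟨{w | w.length = N}, τ '' {w | w.length = N}, hPfin, hPfin.image _, ?_, ?_, τ,
      ⟨Set.mapsTo_image _ _, ?_, Set.surjOn_image _ _⟩, fun p hp => hτ p (le_of_eq hp.symm)⟩
    · refine isMaximalPrefixCode_of_covers
        (fun u hu v hv h => h.eq_of_length (Eq.trans hu (Eq.symm hv))) fun x => ?_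
      exact ⟨x.take N, Stream'.length_take N x, x.drop N, (Stream'.append_take_drop N x).symm⟩
    · refine isMaximalPrefixCode_of_covers ?_ fun x => ?_
      · rintro _ ⟨w, hw, rfl⟩ _ ⟨w', hw', rfl⟩ h
        rw [key w hw w' hw' h]
      · have hlen := Stream'.length_take N (g.symm x)
        refine ⟨_, ⟨(g.symm x).take N, hlen, rfl⟩, (g.symm x).drop N, ?_⟩
        rw [← hτ _ hlen.ge, Stream'.append_take_drop, Equiv.apply_symm_apply]
    · intro w hw w' hw' h
      exact key w hw w' hw' (by rw [h])

/-- Thompson's group `V`: the permutations of the set of infinite words over `{a, b}` that are given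
by a bijection between two finite maximal prefix codes. -/
def thompsonV : Subgroup (Equiv.Perm (Stream' Bool)) where
  carrier := {g | HasFiniteTable g}
  one_mem' := by
    rw [Set.mem_ofPred_eq, hasFiniteTable_iff]
    exact ⟨0, fun w _ => ⟨w, fun y => rfl⟩⟩
  mul_mem' := by
    intro g h hg hh
    rw [Set.mem_ofPred_eq, hasFiniteTable_iff] at hg hh ⊢
    obtain ⟨N, hN⟩ := hg
    obtain ⟨M, hM⟩ := hh
    refine ⟨M + N, fun w hw => ?_⟩
    obtain ⟨v, hv⟩ := hM (w.take M) (by rw [List.length_take]; omega)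
    obtain ⟨u, hu⟩ := hN (v ++ w.drop M) (by rw [List.length_append, List.length_drop]; omega)
    refine ⟨u, fun y => ?_⟩
    rw [Equiv.Perm.mul_apply, ← hu y, Stream'.append_append_stream, ← hv,
      ← Stream'.append_append_stream, List.take_append_drop]
  inv_mem' := by
    rintro g ⟨P, Q, hP, hQ, hPm, hQm, τ, hτ, hg⟩
    have hinv := hτ.invOn_invFunOn
    refine ⟨Q, P, hQ, hP, hQm, hPm, Function.invFunOn τ P, hτ.symm hinv.symm, fun q hq y => ?_⟩
    have hmem : Function.invFunOn τ P q ∈ P := (hτ.symm hinv.symm).mapsTo hq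
    rw [Equiv.Perm.inv_eq_iff_eq, hg _ hmem, hinv.2 hq]

/-- The length of `g` over `S ∪ S⁻¹`: the minimal length of a word in elements of `S` and inverses
of elements of `S` that represents `g` (used only for `g` in the subgroup generated by `S`). -/
noncomputable def wordLength {G : Type*} [Group G] (S : Set G) (g : G) : ℕ :=
  sInf {n : ℕ | ∃ l : List G, l.length = n ∧ (∀ x ∈ l, x ∈ S ∨ x⁻¹ ∈ S) ∧ l.prod = g}

/-- `f` is a distortion function of the subgroup generated by `X` in the group `G` with generating
set `A`: it is non-decreasing and bounds the `X`-length of every element of the subgroup in terms of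
the `A`-length of that element. -/
def IsDistortionFunction {G : Type*} [Group G] (A X : Set G) (f : ℕ → ℕ) : Prop :=
  Monotone f ∧ ∀ g ∈ Subgroup.closure X, wordLength X g ≤ f (wordLength A g)

/-- Linear equivalence of functions: `f₁(n) = O(f₂(O(n)))` and `f₂(n) = O(f₁(O(n)))`. -/
def LinearlyEquivalent (f₁ f₂ : ℕ → ℕ) : Prop :=
  ∃ c₀ C₁₂ c₁₂ C₂₁ c₂₁ : ℕ, 0 < c₀ ∧ 0 < C₁₂ ∧ 0 < c₁₂ ∧ 0 < C₂₁ ∧ 0 < c₂₁ ∧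
    ∀ n ≥ c₀, f₁ n ≤ C₁₂ * f₂ (c₁₂ * n) ∧ f₂ n ≤ C₂₁ * f₁ (c₂₁ * n)

/-! The group $K$ is the image of $G\times G$ under `pairHom`, where the two factors act on the
cones of $a$ and $b$. The gain of a factor $\log n$ comes from comparing word length in $V$ with the
size of tree diagrams: length $n$ gives tree size $O(n)$, while tree size $m$ only gives length
$O(m\log m)$.

An element of $V$ is the map of a binary tree with words on its leaves. Tree size is subadditive
under composition (`size_comp_le`), which gives the first bound, `exists_tree_size_le`. A tree for
$(g,h)\in K$ restricts to trees for $g$ and $h$ that are no larger (`exists_tree_of_cone`).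

The second bound, `exists_wordLength_le`, is a sorting argument. Rearranging a tree near its root,
with labels moving along, is multiplication by a fixed element of $V$, so it has bounded cost
whatever the subtrees are. A tree for $g$ must be rearranged into a tree for the identity with the
same labels. Both are brought, at linear cost, into a form with three stacks near the root; the two
orders of the labels are then matched by radix sort, with $O(\log m)$ passes of cost $O(m)$.

Hence $|g|_A$ and $|h|_A$ are at most $\lceil Nn\log_2(Nn)\rceil$ if $(g,h)$ has length $n>0$ in
$V$. Now $\delta$ bounds $|g|_X$ and $|h|_X$, and $|(g,h)|_Y=O(|g|_X+|h|_X)$. Since a distortion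
function need not be the smallest one, this upper bound suffices. -/

/-! ### Incomparable words and their branches -/

/-- Finite binary trees whose leaves carry finite words. -/
inductive WordTree
  | leaf (p : List Bool) : WordTree
  | node (l r : WordTree) : WordTree

/-- Two words are incomparable if neither is a prefix of the other. -/
def Incomparable (u v : List Bool) : Prop := ¬ u <+: v ∧ ¬ v <+: u

theorem eq_singleton_nil_of_pairwise_incomparable {L : List (List Bool)}
    (hL : L.Pairwise Incomparable) (h : [] ∈ L) : L = [[]] := by
  obtain ⟨L₁, L₂, rfl⟩ := List.append_of_mem h
  rw [List.pairwise_append, List.pairwise_cons] at hL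
  obtain ⟨-, ⟨h2, -⟩, h3⟩ := hL
  have e1 : L₁ = [] := List.eq_nil_iff_forall_not_mem.2 fun x hx =>
    (h3 x hx [] (by simp)).2 (List.nil_prefix)
  have e2 : L₂ = [] := List.eq_nil_iff_forall_not_mem.2 fun x hx =>
    (h2 x hx).1 (List.nil_prefix)
  simp [e1, e2]

/-- Remove the first letter of a word, provided that it is `b`. -/
def stripHead (b : Bool) : List Bool → Option (List Bool)
  | [] => none
  | c :: w => if c = b then some w else none

theorem stripHead_eq_some {b : Bool} {u w : List Bool} :
    stripHead b u = some w ↔ u = b :: w := by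
  cases u with
  | nil => simp [stripHead]
  | cons c u => simp [stripHead]

/-- The words `w` such that `b w` is in the list. -/
def branch (b : Bool) (L : List (List Bool)) : List (List Bool) := L.filterMap (stripHead b)

theorem mem_branch {b : Bool} {L : List (List Bool)} {w : List Bool} :
    w ∈ branch b L ↔ b :: w ∈ L := by
  simp [branch, List.mem_filterMap, stripHead_eq_some]

theorem perm_branch : ∀ {L : List (List Bool)}, [] ∉ L →
    L.Perm ((branch false L).map (List.cons false) ++ (branch true L).map (List.cons true))
  | [], _ => by simp [branch]
  | [] :: L, h => by simp at h
  | (false :: w) :: L, h => by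
    have ih := perm_branch (L := L) (fun h' => h (by simp [h']))
    simpa [branch, stripHead] using ih
  | (true :: w) :: L, h => by
    have ih := perm_branch (L := L) (fun h' => h (by simp [h']))
    simp only [branch, stripHead, List.filterMap_cons, Bool.true_eq_false, if_false, if_true,
      List.map_cons]
    exact (ih.cons _).trans List.perm_middle.symm

theorem pairwise_branch {b : Bool} {L : List (List Bool)} (hL : L.Pairwise Incomparable) :
    (branch b L).Pairwise Incomparable := by
  rw [branch, List.pairwise_filterMap]
  refine hL.imp fun {u v} h x hx y hy => ?_
  rw [stripHead_eq_some] at hx hy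
  subst hx hy
  exact ⟨fun h' => h.1 ((List.prefix_cons_inj b).2 h'), fun h' => h.2 ((List.prefix_cons_inj b).2 h')⟩

/-! ### Trees as maps: composition and size -/

namespace WordTree

/-- The map that replaces the address of a leaf by the label of that leaf. -/
def eval : WordTree → Stream' Bool → Stream' Bool
  | leaf p, y => Stream'.appendStream' p y
  | node l r, y => bif y.head then r.eval y.tail else l.eval y.tail

/-- The number of inner nodes. -/
def size : WordTree → ℕ
  | leaf _ => 0
  | node l r => l.size + r.size + 1

/-- The labels of the leaves, from left to right. -/
def leaves : WordTree → List (List Bool)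
  | leaf p => [p]
  | node l r => l.leaves ++ r.leaves

/-- Apply a function to all labels. -/
def map (f : List Bool → List Bool) : WordTree → WordTree
  | leaf p => leaf (f p)
  | node l r => node (l.map f) (r.map f)

/-- A tree for the restriction of the map of a tree to a cone. -/
def restrict : List Bool → WordTree → WordTree
  | [], t => t
  | b :: v, leaf p => leaf (p ++ b :: v)
  | b :: v, node l r => bif b then restrict v r else restrict v l

/-- A tree for the composition of the maps of two trees. -/
def comp (t : WordTree) : WordTree → WordTree
  | leaf v => restrict v t
  | node l r => node (t.comp l) (t.comp r)

@[simp] theorem eval_leaf (p : List Bool) (y : Stream' Bool) :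
    (leaf p).eval y = Stream'.appendStream' p y := rfl

@[simp] theorem eval_node_cons (l r : WordTree) (b : Bool) (y : Stream' Bool) :
    (node l r).eval (Stream'.cons b y) = bif b then r.eval y else l.eval y := rfl

theorem length_leaves : ∀ t : WordTree, t.leaves.length = t.size + 1
  | leaf _ => rfl
  | node l r => by
    rw [leaves, List.length_append, length_leaves l, length_leaves r, size]
    omega

theorem leaves_map (f : List Bool → List Bool) : ∀ t : WordTree,
    (t.map f).leaves = t.leaves.map f
  | leaf _ => rfl
  | node l r => by rw [map, leaves, leaves_map f l, leaves_map f r, leaves, List.map_append]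

theorem size_map (f : List Bool → List Bool) : ∀ t : WordTree, (t.map f).size = t.size
  | leaf _ => rfl
  | node l r => by rw [map, size, size_map f l, size_map f r, size]

theorem eval_map_cons (b : Bool) (t : WordTree) (y : Stream' Bool) :
    (t.map (List.cons b)).eval y = Stream'.cons b (t.eval y) := by
  induction t generalizing y with
  | leaf p => rfl
  | node l r ihl ihr =>
    rw [← Stream'.eta y, map, eval_node_cons, eval_node_cons, ihl, ihr]
    cases y.head <;> rfl

theorem eval_restrict (v : List Bool) (t : WordTree) (y : Stream' Bool) :
    (t.restrict v).eval y = t.eval (Stream'.appendStream' v y) := by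
  induction v generalizing t with
  | nil => cases t <;> rfl
  | cons b v ih =>
    cases t with
    | leaf p => rw [restrict, eval_leaf, Stream'.append_append_stream, eval_leaf]
    | node l r => cases b <;> simp [restrict, Stream'.cons_append_stream, ih]

theorem eval_comp (t s : WordTree) (y : Stream' Bool) : (t.comp s).eval y = t.eval (s.eval y) := by
  induction s generalizing y with
  | leaf p => rw [comp, eval_restrict, eval_leaf]
  | node l r ihl ihr =>
    rw [← Stream'.eta y, comp, eval_node_cons, eval_node_cons, ihl, ihr]
    cases y.head <;> rfl

theorem size_comp (t s : WordTree) :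
    (t.comp s).size = s.size + (s.leaves.map fun v => (t.restrict v).size).sum := by
  induction s with
  | leaf p => simp [comp, size, leaves]
  | node l r ihl ihr =>
    simp only [comp, size, ihl, ihr, leaves, List.map_append, List.sum_append]
    omega

/-- Incomparable words address disjoint subtrees of `t`, or positions below leaves, where the
restriction has size 0. The inductive step splits the list by first letter; if the empty word
occurs, it is the only word. -/
theorem sum_size_restrict_le (t : WordTree) {L : List (List Bool)}
    (hL : L.Pairwise Incomparable) : (L.map fun v => (t.restrict v).size).sum ≤ t.size := by
  induction t generalizing L with
  | leaf p =>
    refine le_of_eq (List.sum_eq_zero fun x hx => ?_)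
    obtain ⟨v, -, rfl⟩ := List.mem_map.1 hx
    cases v <;> rfl
  | node l r ihl ihr =>
    by_cases h : [] ∈ L
    · rw [eq_singleton_nil_of_pairwise_incomparable hL h]
      simp [restrict]
    · rw [((perm_branch h).map _).sum_eq, List.map_append, List.sum_append, List.map_map,
        List.map_map]
      have h1 := ihl (pairwise_branch (b := false) hL)
      have h2 := ihr (pairwise_branch (b := true) hL)
      have e1 : ((fun v => (restrict v (node l r)).size) ∘ List.cons false) =
        fun v => (l.restrict v).size := rfl
      have e2 : ((fun v => (restrict v (node l r)).size) ∘ List.cons true) =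
        fun v => (r.restrict v).size := rfl
      rw [e1, e2, size]
      omega

theorem exists_eval_of_mem_leaves {t : WordTree} {p : List Bool} (hp : p ∈ t.leaves) :
    ∃ u : List Bool, ∀ y, t.eval (Stream'.appendStream' u y) = Stream'.appendStream' p y := by
  induction t with
  | leaf q =>
    obtain rfl : p = q := by simpa [leaves] using hp
    exact ⟨[], fun y => rfl⟩
  | node l r ihl ihr =>
    rcases List.mem_append.1 hp with h | h
    · obtain ⟨u, hu⟩ := ihl h
      exact ⟨false :: u, hu⟩
    · obtain ⟨u, hu⟩ := ihr h
      exact ⟨true :: u, hu⟩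

theorem exists_mem_leaves (t : WordTree) (y : Stream' Bool) :
    ∃ p ∈ t.leaves, ∃ z, t.eval y = Stream'.appendStream' p z := by
  induction t generalizing y with
  | leaf q => exact ⟨q, by simp [leaves], y, rfl⟩
  | node l r ihl ihr =>
    rw [← Stream'.eta y, eval_node_cons]
    cases y.head
    · obtain ⟨p, hp, z, hz⟩ := ihl y.tail
      exact ⟨p, List.mem_append_left _ hp, z, hz⟩
    · obtain ⟨p, hp, z, hz⟩ := ihr y.tail
      exact ⟨p, List.mem_append_right _ hp, z, hz⟩

/-- If one label were a prefix of another, the images of the two leaf cones would meet, against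
injectivity. -/
theorem pairwise_leaves {t : WordTree} (ht : Function.Injective t.eval) :
    t.leaves.Pairwise Incomparable := by
  induction t with
  | leaf q => simp [leaves]
  | node l r ihl ihr =>
    have key : ∀ p ∈ l.leaves, ∀ q ∈ r.leaves, ∀ x y,
        Stream'.appendStream' p x ≠ Stream'.appendStream' q y := by
      intro p hp q hq x y hxy
      obtain ⟨u, hu⟩ := exists_eval_of_mem_leaves hp
      obtain ⟨v, hv⟩ := exists_eval_of_mem_leaves hq
      rw [← hu, ← hv] at hxy
      have := congrArg Stream'.head (@ht (Stream'.cons false _) (Stream'.cons true _) hxy)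
      simp at this
    refine List.pairwise_append.2 ⟨ihl fun x y h => ?_, ihr fun x y h => ?_, fun p hp q hq => ⟨?_, ?_⟩⟩
    · exact Stream'.cons_injective_right false (@ht (Stream'.cons false x) (Stream'.cons false y) h)
    · exact Stream'.cons_injective_right true (@ht (Stream'.cons true x) (Stream'.cons true y) h)
    · rintro ⟨z, rfl⟩
      exact key p hp _ hq (Stream'.appendStream' z (Stream'.const true)) (Stream'.const true)
        (by rw [Stream'.append_append_stream])
    · rintro ⟨z, rfl⟩
      exact key _ hp q hq (Stream'.const true) (Stream'.appendStream' z (Stream'.const true))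
        (by rw [Stream'.append_append_stream])

/-- The composite grafts a restriction of `t` at each leaf of `s`. Injectivity makes the labels of
`s` incomparable, so the grafted parts have total size at most that of `t`. -/
theorem size_comp_le (t : WordTree) {s : WordTree} (hs : Function.Injective s.eval) :
    (t.comp s).size ≤ t.size + s.size := by
  rw [size_comp]
  have := t.sum_size_restrict_le (pairwise_leaves hs)
  omega

theorem exists_eval_eq_of_forall_length (N : ℕ) : ∀ f : Stream' Bool → Stream' Bool,
    (∀ w : List Bool, w.length = N → ∃ v : List Bool, ∀ y,
      f (Stream'.appendStream' w y) = Stream'.appendStream' v y) → ∃ t : WordTree, t.eval = f := by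
  induction N with
  | zero =>
    intro f hf
    obtain ⟨v, hv⟩ := hf [] rfl
    exact ⟨leaf v, funext fun y => (hv y).symm⟩
  | succ N ih =>
    intro f hf
    have h : ∀ b, ∃ t : WordTree, t.eval = fun y => f (Stream'.cons b y) := fun b =>
      ih _ fun w hw => hf (b :: w) (by simp [hw])
    obtain ⟨l, hl⟩ := h false
    obtain ⟨r, hr⟩ := h true
    refine ⟨node l r, funext fun y => ?_⟩
    rw [← Stream'.eta y, eval_node_cons, hl, hr]
    cases y.head <;> rfl

theorem exists_eval_eq (g : thompsonV) : ∃ t : WordTree, t.eval = (g : Equiv.Perm (Stream' Bool)) := by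
  obtain ⟨N, hN⟩ := (hasFiniteTable_iff _).1 g.2
  exact exists_eval_eq_of_forall_length N _ fun w hw => hN w hw.ge

/-- A finite complete list of pairwise incomparable words is the list of leaf addresses of a
tree. -/
theorem exists_eval_eq_id_of_complete (n : ℕ) : ∀ L : List (List Bool), (L.map List.length).sum ≤ n →
    L.Pairwise Incomparable → (∀ x : Stream' Bool, ∃ p ∈ L, ∃ z, x = Stream'.appendStream' p z) →
    ∃ t : WordTree, (∀ y, t.eval y = y) ∧ t.leaves.Perm L := by
  induction n with
  | zero =>
    intro L hn hL hc
    obtain ⟨p, hp, -⟩ := hc (Stream'.const true)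
    have : p.length ≤ 0 := (List.single_le_sum (by simp) _ (List.mem_map_of_mem hp)).trans hn
    obtain rfl : p = [] := List.length_eq_zero_iff.1 (by omega)
    exact ⟨leaf [], fun y => rfl, by rw [eq_singleton_nil_of_pairwise_incomparable hL hp, leaves]⟩
  | succ n ih =>
    intro L hn hL hc
    by_cases h : [] ∈ L
    · exact ⟨leaf [], fun y => rfl, by rw [eq_singleton_nil_of_pairwise_incomparable hL h, leaves]⟩
    have hp := perm_branch h
    -- Completeness, tested on a constant infinite word, makes each branch nonempty. Stripping first
    -- letters therefore lowers the total length, and induction applies to both branches.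
    have hne : ∀ b, branch b L ≠ [] := by
      intro b hb
      obtain ⟨p, hp, z, hz⟩ := hc (Stream'.const b)
      cases p with
      | nil => exact h hp
      | cons c p =>
        have := congrArg Stream'.head hz
        have e : b = c := this
        subst e
        rw [← mem_branch, hb] at hp
        simp at hp
    have hsum := (hp.map List.length).sum_eq
    have hlen : ∀ b (M : List (List Bool)),
        ((M.map (List.cons b)).map List.length).sum = (M.map List.length).sum + M.length := by
      intro b M
      induction M with
      | nil => rfl
      | cons a M ih => simp only [List.map_cons, List.sum_cons, ih, List.length_cons]; omega
    rw [List.map_append, List.sum_append, hlen, hlen] at hsum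
    have hpos := fun b => List.length_pos_of_ne_nil (hne b)
    have hf := hpos false
    have ht := hpos true
    have hcov : ∀ b (x : Stream' Bool), ∃ p ∈ branch b L, ∃ z, x = Stream'.appendStream' p z := by
      intro b x
      obtain ⟨p, hp, z, hz⟩ := hc (Stream'.cons b x)
      cases p with
      | nil => exact absurd hp h
      | cons c p =>
        obtain ⟨rfl, h2⟩ := Stream'.cons_injective2 (hz : _ = Stream'.cons c _)
        exact ⟨p, mem_branch.2 hp, z, h2⟩
    obtain ⟨l, hl, hl'⟩ := ih (branch false L) (by omega) (pairwise_branch hL) (hcov false)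
    obtain ⟨r, hr, hr'⟩ := ih (branch true L) (by omega) (pairwise_branch hL) (hcov true)
    refine ⟨node (l.map (List.cons false)) (r.map (List.cons true)), fun y => ?_, ?_⟩
    · rw [← Stream'.eta y, eval_node_cons, eval_map_cons, eval_map_cons, hl, hr]
      cases y.head <;> rfl
    · rw [leaves, leaves_map, leaves_map]
      exact ((hl'.map _).append (hr'.map _)).trans hp.symm

/-- This supplies the target of the sorting: a tree for the identity with the same labels as `t`,
possibly in another order. -/
theorem exists_eval_eq_id {t : WordTree} (ht : Function.Bijective t.eval) :
    ∃ t' : WordTree, (∀ y, t'.eval y = y) ∧ t'.leaves.Perm t.leaves := by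
  refine exists_eval_eq_id_of_complete _ t.leaves le_rfl (pairwise_leaves ht.1) fun x => ?_
  obtain ⟨y, rfl⟩ := ht.2 x
  exact t.exists_mem_leaves y

end WordTree

/-! ### Word length with respect to a subset -/

section WordLength

variable {G : Type*} [Group G] {S : Set G}

theorem exists_list_length_eq_wordLength {g : G} (hg : g ∈ Subgroup.closure S) :
    ∃ l : List G, l.length = wordLength S g ∧ (∀ x ∈ l, x ∈ S ∨ x⁻¹ ∈ S) ∧ l.prod = g := by
  refine Nat.sInf_mem (s := {n : ℕ | ∃ l : List G, l.length = n ∧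
    (∀ x ∈ l, x ∈ S ∨ x⁻¹ ∈ S) ∧ l.prod = g}) ?_
  suffices h : ∃ l : List G, (∀ x ∈ l, x ∈ S ∨ x⁻¹ ∈ S) ∧ l.prod = g by
    obtain ⟨l, hl⟩ := h
    exact ⟨l.length, l, rfl, hl⟩
  induction hg using Subgroup.closure_induction with
  | mem x hx => exact ⟨[x], by simp [hx], by simp⟩
  | one => exact ⟨[], by simp, rfl⟩
  | mul x y _ _ ihx ihy =>
    obtain ⟨l, hl, rfl⟩ := ihx
    obtain ⟨l', hl', rfl⟩ := ihy
    refine ⟨l ++ l', fun z hz => ?_, List.prod_append⟩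
    exact (List.mem_append.1 hz).elim (hl z) (hl' z)
  | inv x _ ih =>
    obtain ⟨l, hl, rfl⟩ := ih
    refine ⟨(l.map fun x => x⁻¹).reverse, fun z hz => ?_, (List.prod_inv_reverse l).symm⟩
    obtain ⟨x, hx, rfl⟩ := List.mem_map.1 (List.mem_reverse.1 hz)
    simpa [or_comm] using hl x hx

theorem wordLength_prod_le {l : List G} (hl : ∀ x ∈ l, x ∈ S ∨ x⁻¹ ∈ S) :
    wordLength S l.prod ≤ l.length :=
  Nat.sInf_le ⟨l, rfl, hl, rfl⟩

theorem wordLength_one : wordLength S (1 : G) = 0 :=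
  Nat.le_zero.1 (wordLength_prod_le (l := []) (by simp))

theorem wordLength_mul_le {g h : G} (hg : g ∈ Subgroup.closure S) (hh : h ∈ Subgroup.closure S) :
    wordLength S (g * h) ≤ wordLength S g + wordLength S h := by
  obtain ⟨l, hl, hl', rfl⟩ := exists_list_length_eq_wordLength hg
  obtain ⟨m, hm, hm', rfl⟩ := exists_list_length_eq_wordLength hh
  rw [← hl, ← hm, ← List.length_append, ← List.prod_append]
  refine wordLength_prod_le fun z hz => ?_
  exact (List.mem_append.1 hz).elim (hl' z) (hm' z)

theorem wordLength_inv_le {g : G} (hg : g ∈ Subgroup.closure S) :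
    wordLength S g⁻¹ ≤ wordLength S g := by
  obtain ⟨l, hl, hl', rfl⟩ := exists_list_length_eq_wordLength hg
  rw [← hl, List.prod_inv_reverse]
  refine (wordLength_prod_le fun z hz => ?_).trans (by simp)
  obtain ⟨x, hx, rfl⟩ := List.mem_map.1 (List.mem_reverse.1 hz)
  simpa [or_comm] using hl' x hx

/-- A function on a group that is subadditive on products is bounded by a multiple of the word
length. -/
theorem exists_le_mul_wordLength (hS : S.Finite) (φ : G → ℕ) (h1 : φ 1 = 0)
    (hmul : ∀ g ∈ Subgroup.closure S, ∀ h ∈ Subgroup.closure S, φ (g * h) ≤ φ g + φ h) :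
    ∃ C, ∀ g ∈ Subgroup.closure S, φ g ≤ C * wordLength S g := by
  obtain ⟨C, hC⟩ := (hS.image φ).bddAbove
  obtain ⟨D, hD⟩ := (hS.image fun x => φ x⁻¹).bddAbove
  refine ⟨C + D, fun g hg => ?_⟩
  obtain ⟨l, hl, hl', rfl⟩ := exists_list_length_eq_wordLength hg
  rw [← hl]
  clear hl hg
  induction l with
  | nil => simp [h1]
  | cons x l ih =>
    have hx : φ x ≤ C + D := by
      rcases hl' x (by simp) with h | h
      · exact (hC (Set.mem_image_of_mem φ h)).trans (Nat.le_add_right C D)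
      · have := hD (Set.mem_image_of_mem (fun x => φ x⁻¹) h)
        rw [inv_inv] at this
        exact this.trans (Nat.le_add_left D C)
    have hmem : ∀ y, y ∈ x :: l → y ∈ Subgroup.closure S := by
      intro y hy
      rcases hl' y hy with h | h
      · exact Subgroup.subset_closure h
      · exact (Subgroup.inv_mem_iff _).1 (Subgroup.subset_closure h)
    rw [List.prod_cons, List.length_cons]
    have := hmul x (hmem x (by simp)) l.prod
      (Subgroup.list_prod_mem _ fun y hy => hmem y (List.mem_cons_of_mem _ hy))
    have ih := ih fun y hy => hl' y (List.mem_cons_of_mem _ hy)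
    rw [mul_add, mul_one]
    omega

end WordLength

/-! ### The embedding of $V\times V$, the swap and the rotation -/

theorem stream_ext_cons {P : Stream' Bool → Prop} (h : ∀ b y, P (Stream'.cons b y))
    (y : Stream' Bool) : P y := by
  rw [← Stream'.eta y]
  exact h _ _

/-- The permutation acting as `g` on the words beginning with `a` and as `h` on the words beginning
with `b`. -/
def pairPerm (g h : Equiv.Perm (Stream' Bool)) : Equiv.Perm (Stream' Bool) where
  toFun y := bif y.head then Stream'.cons true (h y.tail) else Stream'.cons false (g y.tail)
  invFun y := bif y.head then Stream'.cons true (h.symm y.tail)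
    else Stream'.cons false (g.symm y.tail)
  left_inv := stream_ext_cons fun b y => by cases b <;> simp
  right_inv := stream_ext_cons fun b y => by cases b <;> simp

theorem pairPerm_mem {g h : Equiv.Perm (Stream' Bool)} (hg : g ∈ thompsonV) (hh : h ∈ thompsonV) :
    pairPerm g h ∈ thompsonV := by
  obtain ⟨N, hN⟩ := (hasFiniteTable_iff _).1 hg
  obtain ⟨M, hM⟩ := (hasFiniteTable_iff _).1 hh
  refine (hasFiniteTable_iff _).2 ⟨N + M + 1, fun w hw => ?_⟩
  match w, hw with
  | false :: w, hw =>
    obtain ⟨v, hv⟩ := hN w (by rw [List.length_cons] at hw; omega)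
    exact ⟨false :: v, fun y => congrArg (Stream'.cons false) (hv y)⟩
  | true :: w, hw =>
    obtain ⟨v, hv⟩ := hM w (by rw [List.length_cons] at hw; omega)
    exact ⟨true :: v, fun y => congrArg (Stream'.cons true) (hv y)⟩

/-- The embedding of `V × V` into `V` by the actions on the two cones. -/
def pairHom : thompsonV × thompsonV →* thompsonV where
  toFun g := ⟨pairPerm g.1 g.2, pairPerm_mem g.1.2 g.2.2⟩
  map_one' := Subtype.ext <| Equiv.ext <| stream_ext_cons fun b y => by cases b <;> rfl
  map_mul' g h := Subtype.ext <| Equiv.ext <| stream_ext_cons fun b y => by cases b <;> rfl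

theorem pairHom_apply_cons (g : thompsonV × thompsonV) (b : Bool) (y : Stream' Bool) :
    (pairHom g : Equiv.Perm (Stream' Bool)) (Stream'.cons b y) =
      bif b then Stream'.cons true ((g.2 : Equiv.Perm (Stream' Bool)) y)
        else Stream'.cons false ((g.1 : Equiv.Perm (Stream' Bool)) y) := rfl

theorem pairHom_injective : Function.Injective pairHom := by
  intro g h hgh
  have key : ∀ b y, (pairHom g : Equiv.Perm (Stream' Bool)) (Stream'.cons b y) =
      (pairHom h : Equiv.Perm (Stream' Bool)) (Stream'.cons b y) := fun b y => by rw [hgh]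
  refine Prod.ext (Subtype.ext <| Equiv.ext fun y => ?_) (Subtype.ext <| Equiv.ext fun y => ?_)
  · exact Stream'.cons_injective_right false (key false y)
  · exact Stream'.cons_injective_right true (key true y)

/-- The element of `V` that exchanges the two cones. -/
def swapV : thompsonV where
  val :=
    { toFun := fun y => Stream'.cons (!y.head) y.tail
      invFun := fun y => Stream'.cons (!y.head) y.tail
      left_inv := stream_ext_cons fun b y => by cases b <;> rfl
      right_inv := stream_ext_cons fun b y => by cases b <;> rfl }
  property := (hasFiniteTable_iff _).2 ⟨1, fun w hw => by
    match w, hw with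
    | b :: w, _ => exact ⟨(!b) :: w, fun y => rfl⟩⟩

/-- The element of `V` with table `aa ↦ a`, `ab ↦ ba`, `b ↦ bb`. -/
def rotV : thompsonV where
  val :=
    { toFun := fun y => bif y.head then Stream'.cons true y else
        bif y.tail.head then Stream'.cons true (Stream'.cons false y.tail.tail) else y.tail
      invFun := fun y => bif y.head then
          (bif y.tail.head then y.tail else Stream'.cons false (Stream'.cons true y.tail.tail))
        else Stream'.cons false y
      left_inv := stream_ext_cons fun b => stream_ext_cons fun c y => by cases b <;> cases c <;> rfl
      right_inv := stream_ext_cons fun b => stream_ext_cons fun c y => by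
        cases b <;> cases c <;> rfl }
  property := (hasFiniteTable_iff _).2 ⟨2, fun w hw => by
    match w, hw with
    | false :: false :: w, _ => exact ⟨false :: w, fun y => rfl⟩
    | false :: true :: w, _ => exact ⟨true :: false :: w, fun y => rfl⟩
    | true :: b :: w, _ => exact ⟨true :: true :: b :: w, fun y => rfl⟩⟩

/-! ### Tree moves realised by fixed elements of $V$ -/

namespace WordTree

/-- The element `s` of `V` rearranges the tree `t` into the tree `t'`. -/
def Carries (s : thompsonV) (t t' : WordTree) : Prop :=
  ∀ y, t.eval y = t'.eval ((s : Equiv.Perm (Stream' Bool)) y)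

theorem Carries.trans {s s' : thompsonV} {t t' t'' : WordTree} (h : Carries s t t')
    (h' : Carries s' t' t'') : Carries (s' * s) t t'' := fun y => by
  rw [h, h', Subgroup.coe_mul, Equiv.Perm.mul_apply]

theorem Carries.symm {s : thompsonV} {t t' : WordTree} (h : Carries s t t') :
    Carries s⁻¹ t' t := fun y => by
  rw [h, ← Equiv.Perm.mul_apply, ← Subgroup.coe_mul, mul_inv_cancel, Subgroup.coe_one,
    Equiv.Perm.one_apply]

theorem Carries.refl (t : WordTree) : Carries 1 t t := fun _ => rfl

theorem carries_swap (l r : WordTree) : Carries swapV (node l r) (node r l) :=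
  stream_ext_cons fun b y => by cases b <;> rfl

theorem carries_rot (x y z : WordTree) :
    Carries rotV (node (node x y) z) (node x (node y z)) :=
  stream_ext_cons fun b => stream_ext_cons fun c y => by cases b <;> cases c <;> rfl

theorem Carries.node {s s' : thompsonV} {l l' r r' : WordTree} (h : Carries s l l')
    (h' : Carries s' r r') : Carries (pairHom (s, s')) (node l r) (node l' r') :=
  stream_ext_cons fun b y => by
    rw [pairHom_apply_cons]
    cases b
    · simpa using h y
    · simpa using h' y

/-- The order of quantifiers matters: one element of $V$ performs the move for all subtrees, so each
move has the same bounded cost. -/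
theorem exists_carries_push_left : ∃ s, ∀ A B C x : WordTree,
    Carries s (node (node A B) (node x C)) (node (node (node x A) B) C) :=
  ⟨_, fun A B C x => (carries_swap _ _).trans <| (carries_rot _ _ _).trans <|
    (((Carries.refl x).node (carries_swap C (.node A B)))).trans <|
    ((Carries.refl x).node (carries_rot A B C)).trans <|
    (carries_rot _ _ _).symm.trans (carries_rot _ _ _).symm⟩

theorem exists_carries_push_right : ∃ s, ∀ A B C x : WordTree,
    Carries s (node (node A B) (node x C)) (node (node A (node x B)) C) := by
  obtain ⟨s, hs⟩ := exists_carries_push_left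
  exact ⟨_, fun A B C x => ((carries_swap A B).node (Carries.refl _)).trans <|
    (hs _ _ _ _).trans ((carries_swap _ _).node (Carries.refl _))⟩

/-- `t` is rearranged into `t'` by an element of `V` of length at most `c`. -/
def Conn (S : Set thompsonV) (c : ℕ) (t t' : WordTree) : Prop :=
  ∃ s, wordLength S s ≤ c ∧ Carries s t t'

section Conn

variable {S : Set thompsonV}

theorem Conn.mono {c d : ℕ} {t t' : WordTree} (h : Conn S c t t') (hcd : c ≤ d) : Conn S d t t' :=
  h.imp fun _ hs => ⟨hs.1.trans hcd, hs.2⟩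

theorem Conn.refl (t : WordTree) : Conn S 0 t t := ⟨1, wordLength_one.le, Carries.refl t⟩

theorem Conn.of_eval_eq {t t' : WordTree} (h : t.eval = t'.eval) : Conn S 0 t t' :=
  ⟨1, wordLength_one.le, fun y => by rw [h]; rfl⟩

theorem Conn.trans (hS : Subgroup.closure S = ⊤) {c d : ℕ} {t t' t'' : WordTree}
    (h : Conn S c t t') (h' : Conn S d t' t'') : Conn S (c + d) t t'' := by
  obtain ⟨s, hs, hs'⟩ := h
  obtain ⟨r, hr, hr'⟩ := h'
  have hmem : ∀ g, g ∈ Subgroup.closure S := fun g => hS ▸ Subgroup.mem_top g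
  have := wordLength_mul_le (hmem r) (hmem s)
  exact ⟨r * s, by omega, hs'.trans hr'⟩

theorem Conn.symm (hS : Subgroup.closure S = ⊤) {c : ℕ} {t t' : WordTree}
    (h : Conn S c t t') : Conn S c t' t := by
  obtain ⟨s, hs, hs'⟩ := h
  exact ⟨s⁻¹, (wordLength_inv_le (hS ▸ Subgroup.mem_top s)).trans hs, hs'.symm⟩

/-! ### Sorting labels with three stacks -/

/-- A stack of labels on top of a tree. -/
def stack (e : WordTree) (L : List (List Bool)) : WordTree :=
  L.foldr (fun x t => node (leaf x) t) e

theorem stack_append (e : WordTree) (L M : List (List Bool)) :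
    stack e (L ++ M) = stack (stack e M) L := List.foldr_append

/-- Each inner node of `t` costs one rotation and each leaf one push, which gives `2 * t.size + 1`
moves. -/
theorem exists_conn_flatten (hS : Subgroup.closure S = ⊤) : ∃ c, ∀ A B t C : WordTree,
    Conn S (c * (2 * t.size + 1)) (node (node A B) (node t C))
      (node (node (stack A t.leaves.reverse) B) C) := by
  obtain ⟨s, hs⟩ := exists_carries_push_left
  refine ⟨wordLength S s + wordLength S (pairHom (1, rotV)), fun A B t C => ?_⟩
  set c := wordLength S s + wordLength S (pairHom (1, rotV)) with hc
  induction t generalizing A C with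
  | leaf p =>
    exact ⟨s, by simp [size, hc], hs A B C _⟩
  | node l r ihl ihr =>
    have h1 : Conn S c (.node (.node A B) (.node (.node l r) C))
        (.node (.node A B) (.node l (.node r C))) :=
      ⟨pairHom (1, rotV), by omega, (Carries.refl _).node (carries_rot _ _ _)⟩
    have h2 := (h1.trans hS (ihl A (.node r C))).trans hS (ihr _ C)
    rw [← stack_append, ← List.reverse_append] at h2
    refine h2.mono ?_
    rw [size]
    apply le_of_eq
    ring

theorem exists_conn_unload_left (hS : Subgroup.closure S = ⊤) :
    ∃ c, ∀ (A B C : WordTree) (L : List (List Bool)),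
      Conn S (c * L.length) (node (node (stack A L) B) C)
        (node (node A B) (stack C L.reverse)) := by
  obtain ⟨s, hs⟩ := exists_carries_push_left
  refine ⟨wordLength S s, fun A B C L => ?_⟩
  induction L generalizing C with
  | nil => exact Conn.refl _
  | cons x L ih =>
    have h2 := Conn.trans hS (Conn.symm hS ⟨s, le_rfl, hs (stack A L) B C _⟩)
      (ih (.node (.leaf x) C))
    rw [List.reverse_cons, stack_append]
    exact h2.mono (by rw [List.length_cons]; apply le_of_eq; ring)

theorem exists_conn_unload_right (hS : Subgroup.closure S = ⊤) :
    ∃ c, ∀ (A B C : WordTree) (L : List (List Bool)),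
      Conn S (c * L.length) (node (node A (stack B L)) C)
        (node (node A B) (stack C L.reverse)) := by
  obtain ⟨s, hs⟩ := exists_carries_push_right
  refine ⟨wordLength S s, fun A B C L => ?_⟩
  induction L generalizing C with
  | nil => exact Conn.refl _
  | cons x L ih =>
    have h2 := Conn.trans hS (Conn.symm hS ⟨s, le_rfl, hs A (stack B L) C _⟩)
      (ih (.node (.leaf x) C))
    rw [List.reverse_cons, stack_append]
    exact h2.mono (by rw [List.length_cons]; apply le_of_eq; ring)

/-- The main stack is popped label by label onto one of two auxiliary stacks; popping reverses the
order within each class. -/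
theorem exists_conn_distribute (hS : Subgroup.closure S = ⊤) :
    ∃ c, ∀ (p : List Bool → Bool) (A B C : WordTree) (L : List (List Bool)),
      Conn S (c * L.length) (node (node A B) (stack C L))
        (node (node (stack A (L.filter p).reverse) (stack B (L.filter fun x => !p x).reverse)) C) := by
  obtain ⟨s, hs⟩ := exists_carries_push_left
  obtain ⟨r, hr⟩ := exists_carries_push_right
  refine ⟨wordLength S s + wordLength S r, fun p A B C L => ?_⟩
  induction L generalizing A B with
  | nil => exact Conn.refl _
  | cons x L ih =>
    have key : ∀ A' B', Conn S (wordLength S s + wordLength S r)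
        (.node (.node A B) (.node (.leaf x) (stack C L))) (.node (.node A' B') (stack C L)) →
        Conn S ((wordLength S s + wordLength S r) * (x :: L).length)
          (.node (.node A B) (stack C (x :: L)))
          (.node (.node (stack A' (L.filter p).reverse)
            (stack B' (L.filter fun x => !p x).reverse)) C) := fun A' B' h =>
      (h.trans hS (ih A' B')).mono (by rw [List.length_cons]; apply le_of_eq; ring)
    cases hp : p x
    · have := key A (.node (.leaf x) B) ⟨r, by omega, hr A B _ _⟩
      simpa [hp, stack, List.foldr_append] using this
    · have := key (.node (.leaf x) A) B ⟨s, by omega, hs A B _ _⟩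
      simpa [hp, stack, List.foldr_append] using this

/-- A stable partition of a stack costs linearly many steps. -/
theorem exists_conn_partition (hS : Subgroup.closure S = ⊤) :
    ∃ c, ∀ (p : List Bool → Bool) (A B C : WordTree) (L : List (List Bool)),
      Conn S (c * L.length) (node (node A B) (stack C L))
        (node (node A B) (stack C (L.filter p ++ L.filter fun x => !p x))) := by
  obtain ⟨c, hc⟩ := exists_conn_distribute hS
  obtain ⟨d, hd⟩ := exists_conn_unload_left hS
  obtain ⟨e, he⟩ := exists_conn_unload_right hS
  refine ⟨c + d + e, fun p A B C L => ?_⟩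
  -- Unloading reverses each class a second time and so restores its order. The right stack goes
  -- back first, which leaves the labels satisfying `p` on top.
  have h := ((hc p A B C L).trans hS (he _ B C _)).trans hS (hd A B _ _)
  simp only [List.reverse_reverse, List.length_reverse] at h
  rw [← stack_append] at h
  refine h.mono ?_
  have h1 := Nat.mul_le_mul_left d (List.length_filter_le p L)
  have h2 := Nat.mul_le_mul_left e (List.length_filter_le (fun x => !p x) L)
  rw [add_mul, add_mul]
  omega

/-- Radix sort of a stack. -/
theorem exists_conn_radix (hS : Subgroup.closure S = ⊤) :
    ∃ c, ∀ (key : List Bool → ℕ) (A B C : WordTree) (L : List (List Bool)) (k : ℕ),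
      ∃ L' : List (List Bool), L'.Perm L ∧
        L'.Pairwise (fun x y => key x % 2 ^ k ≤ key y % 2 ^ k) ∧
        Conn S (c * L.length * k) (node (node A B) (stack C L)) (node (node A B) (stack C L')) := by
  obtain ⟨c, hc⟩ := exists_conn_partition hS
  refine ⟨c, fun key A B C L k => ?_⟩
  induction k with
  | zero =>
    exact ⟨L, List.Perm.refl L, by simp [Nat.mod_one, List.pairwise_iff_forall_sublist],
      (Conn.refl _).mono (Nat.zero_le _)⟩
  | succ k ih =>
    obtain ⟨L', hL', hs, hconn⟩ := ih
    set p : List Bool → Bool := fun x => decide (key x / 2 ^ k % 2 = 0) with hp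
    refine ⟨L'.filter p ++ L'.filter fun x => !p x, (List.filter_append_perm p L').trans hL', ?_, ?_⟩
    -- Bit `k` is the leading digit modulo `2 ^ (k + 1)`. Within a class of equal bit `k`, stability
    -- keeps the order by lower bits.
    · have e : ∀ x, key x % 2 ^ (k + 1) = key x % 2 ^ k + 2 ^ k * (key x / 2 ^ k % 2) :=
        fun x => by rw [pow_succ, Nat.mod_mul]
      have hlt : ∀ x, key x % 2 ^ k < 2 ^ k := fun x => Nat.mod_lt _ (by positivity)
      refine List.pairwise_append.2 ⟨?_, ?_, ?_⟩
      · refine List.pairwise_filter.2 (hs.imp fun {x y} h hx hy => ?_)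
        simp only [hp, decide_eq_true_eq] at hx hy
        rw [e, e, hx, hy]
        omega
      · refine List.pairwise_filter.2 (hs.imp fun {x y} h hx hy => ?_)
        simp only [hp, Bool.not_eq_true', decide_eq_false_iff_not, Nat.mod_two_ne_zero] at hx hy
        rw [e, e, hx, hy]
        omega
      · intro x hx y hy
        have hx := (List.mem_filter.1 hx).2
        have hy := (List.mem_filter.1 hy).2
        simp only [hp, Bool.not_eq_true', decide_eq_true_eq, decide_eq_false_iff_not,
          Nat.mod_two_ne_zero] at hx hy
        rw [e, e, hx, hy]
        have := hlt x
        omega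
    · refine (hconn.trans hS (hc p A B C L')).mono ?_
      rw [hL'.length_eq]
      apply le_of_eq
      ring

/-- The sorting key of a label is its position in `M`. All positions fit into `Nat.log 2 L.length +
1` bits, so that many passes sort completely, and distinct keys force the result to be `M`. -/
theorem exists_conn_stack_of_perm (hS : Subgroup.closure S = ⊤) :
    ∃ c, ∀ (A B C : WordTree) (L M : List (List Bool)), L.Perm M → M.Nodup →
      Conn S (c * L.length * (Nat.log 2 L.length + 1)) (node (node A B) (stack C L))
        (node (node A B) (stack C M)) := by
  obtain ⟨c, hc⟩ := exists_conn_radix hS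
  refine ⟨c, fun A B C L M hLM hM => ?_⟩
  obtain ⟨L', hL', hs, hconn⟩ := hc M.idxOf A B C L (Nat.log 2 L.length + 1)
  have hlt : ∀ x ∈ M, M.idxOf x % 2 ^ (Nat.log 2 L.length + 1) = M.idxOf x := fun x hx =>
    Nat.mod_eq_of_lt <| (List.idxOf_lt_length_of_mem hx).trans_le <| by
      rw [hLM.length_eq]
      exact (Nat.lt_pow_succ_log_self one_lt_two _).le
  have hperm := hL'.trans hLM
  have hM' : M.Pairwise fun x y => M.idxOf x % 2 ^ (Nat.log 2 L.length + 1) ≤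
      M.idxOf y % 2 ^ (Nat.log 2 L.length + 1) := by
    rw [List.pairwise_iff_getElem]
    intro i j hi hj hij
    rw [hlt _ (List.getElem_mem hi), hlt _ (List.getElem_mem hj), hM.idxOf_getElem, hM.idxOf_getElem]
    exact hij.le
  have : L' = M := hperm.eq_of_pairwise (fun x y hx hy h1 h2 => by
    have hx' := hperm.mem_iff.1 hx
    rw [hlt x hx', hlt y hy] at h1 h2
    exact (List.idxOf_inj hx').1 (le_antisymm h1 h2)) hs hM'
  rwa [this] at hconn

end Conn

end WordTree

/-! ### Bringing a tree into stack form -/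

namespace WordTree

section Conn

variable {S : Set thompsonV}

/-- Every leaf can be brought next to the root. -/
theorem exists_conn_promote_context (hS : Subgroup.closure S = ⊤) :
    ∃ c, ∀ (t U : WordTree) (v : List Bool), v ∈ t.leaves →
      ∃ U' : WordTree, (v :: U'.leaves).Perm (t.leaves ++ U.leaves) ∧
        Conn S (c * t.size) (node t U) (node (leaf v) U') := by
  set c := wordLength S rotV + wordLength S (pairHom (swapV, 1)) with hc
  refine ⟨c, fun t U v hv => ?_⟩
  induction t generalizing U with
  | leaf p =>
    obtain rfl : v = p := by simpa [leaves] using hv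
    exact ⟨U, List.Perm.refl _, Conn.refl _⟩
  | node l r ihl ihr =>
    have hrot : ∀ x y, Conn S (wordLength S rotV) (.node (.node x y) U) (.node x (.node y U)) :=
      fun x y => ⟨rotV, le_rfl, carries_rot _ _ _⟩
    rcases List.mem_append.1 hv with h | h
    · obtain ⟨U', hU', hconn⟩ := ihl (.node r U) h
      refine ⟨U', by simpa [leaves] using hU', ((hrot l r).trans hS hconn).mono ?_⟩
      rw [size, add_assoc, mul_add, mul_add, mul_one]
      omega
    · obtain ⟨U', hU', hconn⟩ := ihr (.node l U) h
      have hswap : Conn S (wordLength S (pairHom (swapV, 1))) (.node (.node l r) U)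
          (.node (.node r l) U) := ⟨_, le_rfl, (carries_swap l r).node (Carries.refl U)⟩
      refine ⟨U', hU'.trans ?_, (hswap.trans hS ((hrot r l).trans hS hconn)).mono ?_⟩
      · rw [leaves, leaves, ← List.append_assoc]
        exact List.perm_append_comm.append_right _
      · rw [size, add_assoc, mul_add, mul_add, mul_one]
        omega

theorem exists_conn_promote (hS : Subgroup.closure S = ⊤) :
    ∃ c, ∀ (t : WordTree) (v : List Bool), t.size ≠ 0 → v ∈ t.leaves →
      ∃ U : WordTree, (v :: U.leaves).Perm t.leaves ∧
        Conn S (c * (t.size + 1)) t (node (leaf v) U) := by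
  obtain ⟨c, hc⟩ := exists_conn_promote_context hS
  refine ⟨c + wordLength S swapV, fun t v ht hv => ?_⟩
  match t, ht with
  | .node l r, _ =>
    rcases List.mem_append.1 hv with h | h
    · obtain ⟨U, hU, hconn⟩ := hc l r v h
      refine ⟨U, hU, hconn.mono (Nat.mul_le_mul (Nat.le_add_right _ _) ?_)⟩
      rw [size]
      omega
    · obtain ⟨U, hU, hconn⟩ := hc r l v h
      refine ⟨U, hU.trans List.perm_append_comm,
        (Conn.trans hS ⟨swapV, le_rfl, carries_swap l r⟩ hconn).mono ?_⟩
      have h1 : c * r.size ≤ c * ((WordTree.node l r).size + 1) :=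
        Nat.mul_le_mul_left _ (by rw [size]; omega)
      have h2 : wordLength S swapV * 1 ≤ wordLength S swapV * ((WordTree.node l r).size + 1) :=
        Nat.mul_le_mul_left _ (by omega)
      rw [add_mul]
      omega

/-- A tree with a chosen leaf `v`, whose other labels are put on a stack. -/
def stackForm (v : List Bool) (L : List (List Bool)) : WordTree :=
  node (node (leaf (v ++ [false, false])) (leaf (v ++ [false, true]))) (stack (leaf (v ++ [true])) L)

theorem eval_leaf_split (v : List Bool) :
    (leaf v).eval = (node (node (leaf (v ++ [false, false])) (leaf (v ++ [false, true])))
      (leaf (v ++ [true]))).eval :=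
  funext <| stream_ext_cons fun b => stream_ext_cons fun c y => by
    cases b <;> cases c <;> simp [Stream'.cons_append_stream]

/-- A promoted leaf `v` is split into three leaves, which serve as bottoms of the three stacks. The
rest of the tree is then flattened onto one stack. Promotion needs an inner node, hence `t.size ≠
0`. -/
theorem exists_conn_stackForm (hS : Subgroup.closure S = ⊤) :
    ∃ c, ∀ (t : WordTree) (v : List Bool), t.size ≠ 0 → v ∈ t.leaves →
      ∃ L : List (List Bool), (v :: L).Perm t.leaves ∧
        Conn S (c * (t.size + 1)) t (stackForm v L) := by
  obtain ⟨c, hc⟩ := exists_conn_promote hS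
  obtain ⟨d, hd⟩ := exists_conn_flatten hS
  obtain ⟨e, he⟩ := exists_conn_unload_left hS
  set r := wordLength S (pairHom (1, swapV) * rotV) with hr
  refine ⟨c + r + 2 * d + e, fun t v ht hv => ?_⟩
  obtain ⟨U, hU, hconn⟩ := hc t v ht hv
  refine ⟨U.leaves, hU, ?_⟩
  set ea := leaf (v ++ [false, false])
  set eb := leaf (v ++ [false, true])
  set ec := leaf (v ++ [true])
  have h0 : Conn S 0 (node (leaf v) U) (node (node (node ea eb) ec) U) := by
    refine Conn.of_eval_eq (funext <| stream_ext_cons fun b y => ?_)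
    rw [eval_node_cons, eval_node_cons, eval_leaf_split]
  have h1 : Conn S r (node (node (node ea eb) ec) U) (node (node ea eb) (node U ec)) :=
    ⟨_, le_rfl, (carries_rot _ _ _).trans ((Carries.refl _).node (carries_swap _ _))⟩
  -- Flattening leaves the labels in reverse order on the left stack; moving them to the main stack
  -- reverses them again.
  have h2 := he ea eb ec U.leaves.reverse
  rw [List.reverse_reverse, List.length_reverse] at h2
  refine ((((hconn.trans hS h0).trans hS h1).trans hS (hd ea eb U ec)).trans hS h2).mono ?_
  have hl := hU.length_eq
  rw [List.length_cons, length_leaves, length_leaves] at hl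
  rw [length_leaves]
  have hs : U.size + 1 = t.size := by omega
  rw [← hs]
  nlinarith [Nat.zero_le (r * U.size), Nat.zero_le (d * U.size), Nat.zero_le (e * U.size)]

end Conn

/-! ### Word length in $V$ versus tree size -/

/-- An element of `V` described by a tree with `m` leaves has word length `O(m log m)`. -/
theorem exists_wordLength_le {S : Set thompsonV} (hS : Subgroup.closure S = ⊤) :
    ∃ c, ∀ (g : thompsonV) (t : WordTree), t.eval = (g : Equiv.Perm (Stream' Bool)) →
      wordLength S g ≤ c * (t.size + 1) * (Nat.log 2 (t.size + 1) + 1) := by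
  obtain ⟨c, hc⟩ := exists_conn_stackForm hS
  obtain ⟨d, hd⟩ := exists_conn_stack_of_perm hS
  refine ⟨2 * c + d, fun g t ht => ?_⟩
  have hbij : Function.Bijective t.eval := ht ▸ (g : Equiv.Perm (Stream' Bool)).bijective
  obtain ⟨t', ht', hp⟩ := exists_eval_eq_id hbij
  have hsize : t'.size = t.size := by
    have := hp.length_eq
    rw [length_leaves, length_leaves] at this
    omega
  -- Since `t'` is a tree for the identity, an element carrying `t` to `t'` is equal to `g`.
  suffices h : Conn S ((2 * c + d) * (t.size + 1) * (Nat.log 2 (t.size + 1) + 1)) t t' by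
    obtain ⟨s, hs, hs'⟩ := h
    have : g = s := Subtype.ext <| Equiv.ext fun y => by rw [← ht, hs', ht']
    rwa [this]
  by_cases h0 : t.size = 0
  · match t, t', h0, hsize with
    | .leaf p, .leaf q, _, _ =>
      obtain rfl : q = p := by simpa [leaves] using hp
      exact (Conn.refl _).mono (Nat.zero_le _)
  · obtain ⟨v, hv⟩ := List.exists_mem_of_length_pos (l := t.leaves) (by rw [length_leaves]; omega)
    obtain ⟨L, hL, h1⟩ := hc t v h0 hv
    obtain ⟨M, hM, h2⟩ := hc t' v (by omega) (hp.mem_iff.2 hv)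
    have hnodup : t'.leaves.Nodup := hp.nodup_iff.2 <| (pairwise_leaves hbij.1).imp
      fun {u w} h (e : u = w) => h.1 (e ▸ List.prefix_refl u)
    have hLM : L.Perm M := (List.perm_cons v).1 ((hL.trans hp.symm).trans hM.symm)
    -- Two linear reductions to stack form with the same leaf `v`, joined by one sort, account for
    -- the constant `2 * c + d`.
    have h3 := (h1.trans hS (hd _ _ _ L M hLM
      (List.nodup_cons.1 (hM.nodup_iff.2 hnodup)).2)).trans hS (h2.symm hS)
    refine h3.mono ?_
    rw [hsize]
    have hlen : L.length ≤ t.size + 1 := by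
      have := hL.length_eq
      rw [List.length_cons, length_leaves] at this
      omega
    have h4 : d * L.length * (Nat.log 2 L.length + 1) ≤
        d * (t.size + 1) * (Nat.log 2 (t.size + 1) + 1) := by
      gcongr
    have h5 : c * (t.size + 1) * 1 ≤ c * (t.size + 1) * (Nat.log 2 (t.size + 1) + 1) := by
      gcongr
      omega
    have h6 : (2 * c + d) * (t.size + 1) * (Nat.log 2 (t.size + 1) + 1) =
      2 * (c * (t.size + 1) * (Nat.log 2 (t.size + 1) + 1)) +
        d * (t.size + 1) * (Nat.log 2 (t.size + 1) + 1) := by ring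
    omega

/-- Elements of word length `n` are described by trees of size `O(n)`. -/
theorem exists_tree_size_le {B : Set thompsonV} (hB : B.Finite) (hgen : Subgroup.closure B = ⊤) :
    ∃ C, ∀ g : thompsonV, ∃ t : WordTree, t.eval = (g : Equiv.Perm (Stream' Bool)) ∧
      t.size ≤ C * wordLength B g := by
  have hex : ∀ g : thompsonV, ∃ n, ∃ t : WordTree,
      t.eval = (g : Equiv.Perm (Stream' Bool)) ∧ t.size = n := fun g =>
    let ⟨t, ht⟩ := exists_eval_eq g
    ⟨t.size, t, ht, rfl⟩
  classical
  -- The least size of a tree for an element is subadditive on products by `size_comp_le`, and it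
  -- vanishes at the identity.
  obtain ⟨C, hC⟩ := exists_le_mul_wordLength hB (fun g => Nat.find (hex g))
    (Nat.le_zero.1 (Nat.find_min' _ ⟨leaf [], funext fun y => rfl, rfl⟩)) (by
      intro g _ h _
      obtain ⟨t, ht, ht'⟩ := Nat.find_spec (hex g)
      obtain ⟨s, hs, hs'⟩ := Nat.find_spec (hex h)
      refine (Nat.find_min' _ ⟨t.comp s, funext fun y => ?_, rfl⟩).trans
        ((size_comp_le t (hs ▸ (h : Equiv.Perm (Stream' Bool)).injective)).trans (by rw [ht', hs']))
      rw [eval_comp, ht, hs]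
      rfl)
  refine ⟨C, fun g => ?_⟩
  obtain ⟨t, ht, ht'⟩ := Nat.find_spec (hex g)
  exact ⟨t, ht, ht'.trans_le (hC g (hgen ▸ Subgroup.mem_top g))⟩

/-- All labels must be nonempty because `List.tail` fixes the empty word, so that no letter would be
removed there. -/
theorem eval_map_tail {t : WordTree} (b : Bool) (f : Stream' Bool → Stream' Bool)
    (h : ∀ y, t.eval y = Stream'.cons b (f y)) (hnil : [] ∉ t.leaves) :
    (t.map List.tail).eval = f := by
  induction t generalizing f with
  | leaf p =>
    match p with
    | [] => simp [leaves] at hnil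
    | c :: p => exact funext fun y => (Stream'.cons_injective2
        (show Stream'.cons c (Stream'.appendStream' p y) = Stream'.cons b (f y) from h y)).2
  | node l r ihl ihr =>
    rw [leaves, List.mem_append, not_or] at hnil
    have hl := ihl (fun y => f (Stream'.cons false y)) (fun y => h (Stream'.cons false y)) hnil.1
    have hr := ihr (fun y => f (Stream'.cons true y)) (fun y => h (Stream'.cons true y)) hnil.2
    refine funext <| stream_ext_cons fun c y => ?_
    rw [map, eval_node_cons, hl, hr]
    cases c <;> rfl

theorem exists_tree_of_cone {t : WordTree} (b : Bool) {f : Stream' Bool → Stream' Bool}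
    (h : ∀ y, t.eval (Stream'.cons b y) = Stream'.cons b (f y)) :
    ∃ t' : WordTree, t'.eval = f ∧ t'.size ≤ t.size := by
  have h' : ∀ y, (t.restrict [b]).eval y = Stream'.cons b (f y) := fun y => by
    rw [eval_restrict]
    exact h y
  refine ⟨(t.restrict [b]).map List.tail, eval_map_tail b f h' fun hnil => ?_, ?_⟩
  -- An empty label would make the image contain every infinite word, including one with the wrong
  -- first letter.
  · obtain ⟨u, hu⟩ := exists_eval_of_mem_leaves hnil
    have h1 := hu (Stream'.const !b)
    rw [h'] at h1
    have := congrArg Stream'.head h1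
    cases b <;> cases this
  · rw [size_map]
    cases t with
    | leaf p => exact le_rfl
    | node l r => cases b <;> simp [restrict, size] <;> omega

end WordTree

/-! ### Distortion of the image of $G\times G$ -/

/-- The word length of the components of an element of `V × V ≤ V`. -/
theorem exists_wordLength_components_le {A B : Set thompsonV} (hA : Subgroup.closure A = ⊤)
    (hB : B.Finite) (hBgen : Subgroup.closure B = ⊤) :
    ∃ N : ℕ, 0 < N ∧ ∀ g : thompsonV × thompsonV, 0 < wordLength B (pairHom g) →
      wordLength A g.1 ≤ ⌈((N * wordLength B (pairHom g) : ℕ) : ℝ) *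
        Real.logb 2 ((N * wordLength B (pairHom g) : ℕ) : ℝ)⌉₊ ∧
      wordLength A g.2 ≤ ⌈((N * wordLength B (pairHom g) : ℕ) : ℝ) *
        Real.logb 2 ((N * wordLength B (pairHom g) : ℕ) : ℝ)⌉₊ := by
  obtain ⟨c, hc⟩ := WordTree.exists_wordLength_le hA
  obtain ⟨C, hC⟩ := WordTree.exists_tree_size_le hB hBgen
  -- The factor 2 absorbs the summand 1 in `Nat.log 2 m + 1`, as $1+\log_2 m=\log_2(2m)$. The factor
  -- `C + 1` absorbs the 1 in `t'.size + 1`, which needs a positive length.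
  refine ⟨2 * (c + 1) * (C + 1), by positivity, fun g hn => ?_⟩
  obtain ⟨t, ht, hts⟩ := hC (pairHom g)
  set n := wordLength B (pairHom g)
  have key : ∀ h : thompsonV, (∃ t' : WordTree, t'.eval = (h : Equiv.Perm (Stream' Bool)) ∧
      t'.size ≤ t.size) → wordLength A h ≤ ⌈((2 * (c + 1) * (C + 1) * n : ℕ) : ℝ) *
        Real.logb 2 ((2 * (c + 1) * (C + 1) * n : ℕ) : ℝ)⌉₊ := by
    rintro h ⟨t', ht', hs⟩
    have hm : t'.size + 1 ≤ (C + 1) * n := by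
      rw [add_mul]
      omega
    set m := t'.size + 1
    have h1 := hc h t' ht'
    refine h1.trans (Nat.cast_le (α := ℝ).1 (le_trans ?_ (Nat.le_ceil _)))
    change ((c * m * (Nat.log 2 m + 1) : ℕ) : ℝ) ≤ _
    push_cast
    have hm1 : (1 : ℝ) ≤ m := by exact_mod_cast Nat.le_add_left 1 _
    have hm' : (m : ℝ) ≤ (C + 1) * n := by exact_mod_cast hm
    have hc0 : (0 : ℝ) ≤ c := Nat.cast_nonneg c
    have hX : (0 : ℝ) ≤ (C + 1) * n := by positivity
    have h2 : (Nat.log 2 m : ℝ) + 1 ≤ Real.logb 2 (2 * (c + 1) * (C + 1) * n) := by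
      have e1 : (Nat.log 2 m : ℝ) ≤ Real.logb 2 m := by exact_mod_cast Real.natLog_le_logb m 2
      have e2 : Real.logb 2 (2 * m) = 1 + Real.logb 2 m := by
        rw [Real.logb_mul (by norm_num) (by positivity), Real.logb_self_eq_one (by norm_num)]
      have e3 : Real.logb 2 (2 * m) ≤ Real.logb 2 (2 * (c + 1) * (C + 1) * n) := by
        refine Real.logb_le_logb_of_le (by norm_num) (by positivity) ?_
        nlinarith [mul_nonneg hc0 hX]
      linarith
    refine mul_le_mul ?_ h2 (by positivity) (by positivity)
    nlinarith [mul_nonneg hc0 hX, mul_le_mul_of_nonneg_left hm' hc0]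
  refine ⟨key _ (WordTree.exists_tree_of_cone false fun y => ?_),
    key _ (WordTree.exists_tree_of_cone true fun y => ?_)⟩
  · rw [ht]
    rfl
  · rw [ht]
    rfl

theorem monotone_ceil_mul_logb : Monotone fun n : ℕ => ⌈(n : ℝ) * Real.logb 2 (n : ℝ)⌉₊ := by
  intro m n hmn
  refine Nat.ceil_mono ?_
  rcases Nat.eq_zero_or_pos m with rfl | hm
  · simp only [Nat.cast_zero, zero_mul]
    exact mul_nonneg (Nat.cast_nonneg n) (div_nonneg (Real.log_natCast_nonneg n)
      (Real.log_nonneg (by norm_num)))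
  · have hm' : (1 : ℝ) ≤ m := by exact_mod_cast hm
    have hmn' : (m : ℝ) ≤ n := by exact_mod_cast hmn
    exact mul_le_mul hmn' (Real.logb_le_logb_of_le (by norm_num) (by linarith) hmn')
      (Real.logb_nonneg (by norm_num) hm') (by linarith)

/-- The generating set `Y` of the image of `G × G` under a homomorphism has word length bounded in
terms of the components. -/
theorem exists_wordLength_map_prod_le {G H : Type*} [Group G] [Group H] (φ : G × G →* H) {X : Set G}
    (hX : X.Finite) {Y : Set H}
    (hY : Subgroup.closure Y = ((Subgroup.closure X).prod (Subgroup.closure X)).map φ) :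
    ∃ C, ∀ g ∈ Subgroup.closure X, ∀ h ∈ Subgroup.closure X,
      wordLength Y (φ (g, h)) ≤ C * (wordLength X g + wordLength X h) := by
  have hmem : ∀ g ∈ Subgroup.closure X, ∀ h ∈ Subgroup.closure X,
      φ (g, h) ∈ Subgroup.closure Y := fun g hg h hh =>
    hY ▸ Subgroup.mem_map_of_mem φ (Subgroup.mem_prod.2 ⟨hg, hh⟩)
  have h1 := Subgroup.one_mem (Subgroup.closure X)
  have hφ1 : φ (1, 1) = 1 := φ.map_one
  obtain ⟨C, hC⟩ := exists_le_mul_wordLength hX (fun g => wordLength Y (φ (g, 1)))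
    (by rw [hφ1, wordLength_one]) (fun g hg h hh => by
      have := wordLength_mul_le (hmem g hg 1 h1) (hmem h hh 1 h1)
      rwa [← map_mul, Prod.mk_mul_mk, mul_one] at this)
  obtain ⟨D, hD⟩ := exists_le_mul_wordLength hX (fun g => wordLength Y (φ (1, g)))
    (by rw [hφ1, wordLength_one]) (fun g hg h hh => by
      have := wordLength_mul_le (hmem 1 h1 g hg) (hmem 1 h1 h hh)
      rwa [← map_mul, Prod.mk_mul_mk, mul_one] at this)
  refine ⟨C + D, fun g hg h hh => ?_⟩
  have h2 := wordLength_mul_le (hmem g hg 1 h1) (hmem 1 h1 h hh)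
  rw [← map_mul, Prod.mk_mul_mk, mul_one, one_mul] at h2
  have h3 := hC g hg
  have h4 := hD h hh
  nlinarith [Nat.zero_le (C * wordLength X h), Nat.zero_le (D * wordLength X g)]

theorem mainTheorem10 (G : Subgroup thompsonV)
    (A : Set thompsonV) (hA : A.Finite) (hAgen : Subgroup.closure A = ⊤)
    (X : Set thompsonV) (hX : X.Finite) (hXgen : Subgroup.closure X = G)
    (δ : ℕ → ℕ) (hδ : IsDistortionFunction A X δ) :
    ∃ K : Subgroup thompsonV, Nonempty (K ≃* G × G) ∧ K.FG ∧
      ∀ B : Set thompsonV, B.Finite → Subgroup.closure B = ⊤ →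
      ∀ Y : Set thompsonV, Y.Finite → Subgroup.closure Y = K →
        ∃ f : ℕ → ℕ, IsDistortionFunction B Y f ∧
          LinearlyEquivalent f (fun n => δ ⌈(n : ℝ) * Real.logb 2 (n : ℝ)⌉₊) := by
  subst hXgen
  set G := Subgroup.closure X with hG
  have e : (G.prod G).map pairHom ≃* G × G :=
    ((G.prod G).equivMapOfInjective pairHom pairHom_injective).symm.trans (Subgroup.prodEquiv G G)
  have hGfg : G.FG := (Subgroup.fg_iff G).2 ⟨X, rfl, hX⟩
  refine ⟨(G.prod G).map pairHom, ⟨e⟩, ?_, fun B hB hBgen Y _ hYgen => ?_⟩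
  · have : Group.FG G := (Group.fg_iff_subgroup_fg G).2 hGfg
    rw [← Group.fg_iff_subgroup_fg]
    exact Group.fg_of_surjective (f := e.symm.toMonoidHom) e.symm.surjective
  obtain ⟨N, hN, hN'⟩ := exists_wordLength_components_le hAgen hB hBgen
  obtain ⟨C, hC⟩ := exists_wordLength_map_prod_le pairHom hX hYgen
  set F : ℕ → ℕ := fun n => δ ⌈(n : ℝ) * Real.logb 2 (n : ℝ)⌉₊ with hF
  have hFmono : Monotone F := hδ.1.comp monotone_ceil_mul_logb
  -- The factor is `2 * C` for the two components; adding 1 keeps it positive, as linear equivalence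
  -- and `F n ≤ f n` require.
  refine ⟨fun n => (2 * C + 1) * F (N * n), ⟨fun m n hmn => ?_, fun k hk => ?_⟩,
    1, 2 * C + 1, N, 1, 1, one_pos, by positivity, hN, one_pos, one_pos, fun n _ => ⟨le_rfl, ?_⟩⟩
  · exact Nat.mul_le_mul_left _ (hFmono (Nat.mul_le_mul_left N hmn))
  · rw [hYgen] at hk
    obtain ⟨⟨g, h⟩, hgh, rfl⟩ := hk
    obtain ⟨hg, hh⟩ := Subgroup.mem_prod.1 hgh
    rcases Nat.eq_zero_or_pos (wordLength B (pairHom (g, h))) with h0 | hpos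
    -- Length 0 means that the element is the identity, so its `Y`-length is 0 as well; the
    -- component bounds hold only for positive length.
    · obtain ⟨l, hl, -, hl'⟩ := exists_list_length_eq_wordLength (S := B)
        (hBgen ▸ Subgroup.mem_top (pairHom (g, h)))
      rw [h0, List.length_eq_zero_iff] at hl
      rw [← hl', hl, List.prod_nil, wordLength_one]
      exact Nat.zero_le _
    · obtain ⟨h1, h2⟩ := hN' (g, h) hpos
      have h3 := (hδ.2 g hg).trans (hδ.1 h1)
      have h4 := (hδ.2 h hh).trans (hδ.1 h2)
      refine (hC g hg h hh).trans ((Nat.mul_le_mul_left C (add_le_add h3 h4)).trans ?_)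
      simp only [hF]
      rw [add_mul, one_mul, mul_add, mul_assoc, two_mul]
      exact Nat.le_add_right _ _
  · rw [one_mul, one_mul]
    exact (hFmono (Nat.le_mul_of_pos_left n hN)).trans (Nat.le_mul_of_pos_left _ (by positivity))
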